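/- Let $\mathcal A$ be a non-zero unital complex $C^*$-algebra, let $a\in\mathcal A$, let $\mathcal B$ be a complex linear subspace of $\mathcal A$ (not necessarily closed), and let $b_0$ be a best approximation to $a$ in $\mathcal B$, i.e. $b_0\in\mathcal B$ and $\|a-b_0\|\le\|a-b\|$ for all $b\in\mathcal B$. Let $S_{\mathcal A}$ be the set of states of $\mathcal A$, i.e. of positive linear functionals $\phi$ on $\mathcal A$ with $\phi(1_{\mathcal A})=1$. For $\phi\in S_{\mathcal A}$ let $\mathscr L=\{c\in\mathcal A:\phi(c^*c)=0\}$, a linear subspace of $\mathcal A$, and equip $\mathcal A/\mathscr L$ with the inner product $\langle a_1+\mathscr L\,|\,a_2+\mathscr L\rangle=\phi(a_1^*a_2)$. Write $\mathcal B/\mathscr L=\{b+\mathscr L: b\in\mathcal B\}\subseteq\mathcal A/\mathscr L$, and put $$M_{a,\mathcal B}(\phi)=\sup\Big\{\phi\big((a-b_0)^*(a-b_0)\big)-\sum_\alpha\big|\phi\big((a-b_0)^*b_\alpha\big)\big|^2\Big\},$$ where the supremum is taken over all families $\{b_\alpha\}$ in $\mathcal B$ such that $\{b_\alpha+\mathscr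 L\}$ is an orthonormal basis of $\mathcal B/\mathscr L$, i.e. a maximal orthonormal subset of $\mathcal B/\mathscr L$ (indexed without repetition). Then $$\operatorname{dist}(a,\mathcal B)^2=\max\{M_{a,\mathcal B}(\phi):\phi\in S_{\mathcal A}\};$$ in particular the maximum is attained. -/

import Mathlib

open scoped ComplexOrder InnerProductSpace

noncomputable section

namespace CStarDist

variable {A : Type*} [CStarAlgebra A]

/-- `b₀` is a best approximation to `a` in the subspace `B`. -/
def IsBestApprox (a : A) (B : Submodule ℂ A) (b₀ : A) : Prop :=
  b₀ ∈ B ∧ ∀ b ∈ B, ‖a - b₀‖ ≤ ‖a - b‖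

variable [PartialOrder A] [StarOrderedRing A]

/-- The states of a unital C*-algebra: the positive linear functionals with `φ 1 = 1`. -/
def states (A : Type*) [CStarAlgebra A] [PartialOrder A] [StarOrderedRing A] :
    Set (A →ₚ[ℂ] ℂ) :=
  {φ | φ 1 = 1}

/-- An element of the left kernel is orthogonal to everything (Cauchy-Schwarz). -/
lemma map_star_mul_eq_zero (φ : A →ₚ[ℂ] ℂ) {c : A} (hc : φ (star c * c) = 0) (x : A) :
    φ (star x * c) = 0 := by
  have h0 : ‖φ.toPreGNS c‖ = 0 := by
    have h := φ.preGNS_norm_sq (φ.toPreGNS c)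
    simp only [PositiveLinearMap.ofPreGNS_toPreGNS, hc] at h
    exact_mod_cast pow_eq_zero_iff (two_ne_zero) |>.1 h
  have h1 := norm_inner_le_norm (𝕜 := ℂ) (φ.toPreGNS x) (φ.toPreGNS c)
  rw [h0, mul_zero] at h1
  exact norm_le_zero_iff.1 h1

/-- `φ (x* y)` is the complex conjugate of `φ (y* x)`. -/
lemma conj_map_star_mul (φ : A →ₚ[ℂ] ℂ) (x y : A) :
    (starRingEnd ℂ) (φ (star y * x)) = φ (star x * y) :=
  inner_conj_symm (𝕜 := ℂ) (φ.toPreGNS x) (φ.toPreGNS y)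

/-- The same as `map_star_mul_eq_zero`, in the other variable. -/
lemma map_star_mul_eq_zero' (φ : A →ₚ[ℂ] ℂ) {c : A} (hc : φ (star c * c) = 0) (x : A) :
    φ (star c * x) = 0 := by
  rw [← conj_map_star_mul, map_star_mul_eq_zero φ hc, map_zero]

/-- The left kernel `L = {c | φ (c* c) = 0}` of a positive functional `φ`. -/
def leftKernel (φ : A →ₚ[ℂ] ℂ) : Submodule ℂ A where
  carrier := {c | φ (star c * c) = 0}
  zero_mem' := by simp
  add_mem' {c d} hc hd := by
    simp only [Set.mem_ofPred_eq] at hc hd ⊢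
    rw [mul_add, map_add, map_star_mul_eq_zero φ hc, map_star_mul_eq_zero φ hd, add_zero]
  smul_mem' r c hc := by
    simp only [Set.mem_ofPred_eq] at hc ⊢
    rw [mul_smul_comm, map_smul, map_star_mul_eq_zero φ hc, smul_zero]

lemma mem_leftKernel {φ : A →ₚ[ℂ] ℂ} {c : A} :
    c ∈ leftKernel φ ↔ φ (star c * c) = 0 := Iff.rfl

/-- The vector space `A / L`. It is a separate type (not reducible to the quotient) because it
carries the norm coming from `φ`, and not the quotient norm of the C*-norm. -/
def GNSQuotient (φ : A →ₚ[ℂ] ℂ) : Type _ := A ⧸ leftKernel φ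

instance (φ : A →ₚ[ℂ] ℂ) : AddCommGroup (GNSQuotient φ) :=
  inferInstanceAs (AddCommGroup (A ⧸ leftKernel φ))

instance (φ : A →ₚ[ℂ] ℂ) : Module ℂ (GNSQuotient φ) :=
  inferInstanceAs (Module ℂ (A ⧸ leftKernel φ))

/-- The quotient map `c ↦ c + L` from `A` to `A / L`. -/
def toQuotient (φ : A →ₚ[ℂ] ℂ) : A →ₗ[ℂ] GNSQuotient φ := (leftKernel φ).mkQ

lemma toQuotient_surjective (φ : A →ₚ[ℂ] ℂ) : Function.Surjective (toQuotient φ) :=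
  (leftKernel φ).mkQ_surjective

lemma toQuotient_eq_zero {φ : A →ₚ[ℂ] ℂ} {c : A} :
    toQuotient φ c = 0 ↔ φ (star c * c) = 0 :=
  Submodule.Quotient.mk_eq_zero (leftKernel φ)

/-- The inner product `⟨x + L, y + L⟩ = φ (x* y)` on `A / L`. -/
def quotientInner (φ : A →ₚ[ℂ] ℂ) (u v : GNSQuotient φ) : ℂ :=
  Quotient.liftOn₂' (s₁ := (leftKernel φ).quotientRel) (s₂ := (leftKernel φ).quotientRel) u v
    (fun x y => φ (star x * y)) (by
      intro x₁ y₁ x₂ y₂ hx hy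
      rw [Submodule.quotientRel_def, mem_leftKernel] at hx hy
      have h1 := map_star_mul_eq_zero' φ hx y₁
      have h2 := map_star_mul_eq_zero φ hy x₂
      rw [star_sub, sub_mul, map_sub, sub_eq_zero] at h1
      rw [mul_sub, map_sub, sub_eq_zero] at h2
      exact h1.trans h2)

lemma quotientInner_mk (φ : A →ₚ[ℂ] ℂ) (x y : A) :
    quotientInner φ (toQuotient φ x) (toQuotient φ y) = φ (star x * y) := rfl

/-- `A / L` is an inner product space. -/
@[reducible]
def quotientCore (φ : A →ₚ[ℂ] ℂ) : InnerProductSpace.Core ℂ (GNSQuotient φ) where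
  inner := quotientInner φ
  conj_inner_symm u v := by
    obtain ⟨x, rfl⟩ := toQuotient_surjective φ u
    obtain ⟨y, rfl⟩ := toQuotient_surjective φ v
    exact conj_map_star_mul φ x y
  re_inner_nonneg u := by
    obtain ⟨x, rfl⟩ := toQuotient_surjective φ u
    exact (RCLike.nonneg_iff.mp (φ.map_nonneg (star_mul_self_nonneg x))).1
  add_left u v w := by
    obtain ⟨x, rfl⟩ := toQuotient_surjective φ u
    obtain ⟨y, rfl⟩ := toQuotient_surjective φ v
    obtain ⟨z, rfl⟩ := toQuotient_surjective φ w
    rw [← map_add, quotientInner_mk, quotientInner_mk, quotientInner_mk, star_add, add_mul,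
      map_add]
  smul_left u v r := by
    obtain ⟨x, rfl⟩ := toQuotient_surjective φ u
    obtain ⟨y, rfl⟩ := toQuotient_surjective φ v
    rw [← map_smul, quotientInner_mk, quotientInner_mk, star_smul, smul_mul_assoc, map_smul]
    rfl
  definite u hu := by
    obtain ⟨x, rfl⟩ := toQuotient_surjective φ u
    exact toQuotient_eq_zero.2 hu

instance (φ : A →ₚ[ℂ] ℂ) : NormedAddCommGroup (GNSQuotient φ) :=
  (quotientCore φ).toNormedAddCommGroup

instance (φ : A →ₚ[ℂ] ℂ) : InnerProductSpace ℂ (GNSQuotient φ) :=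
  InnerProductSpace.ofCore (quotientCore φ).toCore

lemma inner_toQuotient (φ : A →ₚ[ℂ] ℂ) (x y : A) :
    ⟪toQuotient φ x, toQuotient φ y⟫_ℂ = φ (star x * y) := rfl

/-- `S` is an orthonormal basis of the subspace `W` of an inner product space `V`: a maximal
orthonormal subset of `W`. Neither `V` nor `W` has to be complete. -/
def IsOrthonormalBasis {V : Type*} [NormedAddCommGroup V] [InnerProductSpace ℂ V]
    (W : Submodule ℂ V) (S : Set V) : Prop :=
  Maximal (fun T : Set V => T ⊆ W ∧ Orthonormal ℂ ((↑) : T → V)) S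

/-- The elements of `T` represent, without repetition, an orthonormal basis of
`B / L = {b + L | b ∈ B}` in `A / L`; that is, `T = {b_α}` is a family in `B` such that
`{b_α + L}` is an orthonormal basis. -/
def RepresentsBasis (φ : A →ₚ[ℂ] ℂ) (B : Submodule ℂ A) (T : Set A) : Prop :=
  T ⊆ B ∧ Set.InjOn (toQuotient φ) T ∧
    IsOrthonormalBasis (B.map (toQuotient φ)) (toQuotient φ '' T)

/-- The number `φ (x* x) - ∑_α |φ (x* b_α)|²` for a family `T = {b_α}`. -/
def defect (φ : A →ₚ[ℂ] ℂ) (x : A) (T : Set A) : ℝ :=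
  (φ (star x * x)).re - ∑' b : T, ‖φ (star x * (b : A))‖ ^ 2

/-- `M(φ)`: the supremum of `φ ((a-b₀)* (a-b₀)) - ∑_α |φ ((a-b₀)* b_α)|²` over all orthonormal
bases `{b_α + L}` of `B / L` in `A / L`. -/
def M (a : A) (B : Submodule ℂ A) (b₀ : A) (φ : A →ₚ[ℂ] ℂ) : ℝ :=
  sSup {r | ∃ T : Set A, RepresentsBasis φ B T ∧ r = defect φ (a - b₀) T}

/-! The sums and the supremum in `M` are meaningful: the sums converge, there is at least one
orthonormal basis, and the numbers are bounded above. -/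

lemma RepresentsBasis.orthonormal {φ : A →ₚ[ℂ] ℂ} {B : Submodule ℂ A} {T : Set A}
    (h : RepresentsBasis φ B T) : Orthonormal ℂ (fun b : T => toQuotient φ (b : A)) :=
  h.2.2.prop.2.comp (fun b : T => ⟨toQuotient φ b, Set.mem_image_of_mem _ b.2⟩)
    (fun b c hbc => Subtype.ext (h.2.1 b.2 c.2 (congrArg Subtype.val hbc)))

lemma RepresentsBasis.summable {φ : A →ₚ[ℂ] ℂ} {B : Submodule ℂ A} {T : Set A}
    (h : RepresentsBasis φ B T) (x : A) :
    Summable (fun b : T => ‖φ (star x * (b : A))‖ ^ 2) := by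
  refine (h.orthonormal.inner_products_summable (toQuotient φ x)).congr fun b => ?_
  rw [norm_inner_symm, inner_toQuotient]

lemma exists_representsBasis (φ : A →ₚ[ℂ] ℂ) (B : Submodule ℂ A) :
    ∃ T : Set A, RepresentsBasis φ B T := by
  obtain ⟨S, -, hS⟩ := zorn_subset_nonempty
    {T : Set (GNSQuotient φ) | T ⊆ B.map (toQuotient φ) ∧
      Orthonormal ℂ ((↑) : T → GNSQuotient φ)}
    (fun c hc hch _ => ⟨⋃₀ c, ⟨Set.sUnion_subset fun s hs => (hc hs).1,
      orthonormal_sUnion_of_directed hch.directedOn fun s hs => (hc hs).2⟩,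
      fun s hs => Set.subset_sUnion_of_mem hs⟩)
    ∅ ⟨Set.empty_subset _, orthonormal_empty ℂ _⟩
  obtain ⟨T, hTB, hT⟩ := Set.SurjOn.exists_bijOn_subset
    (f := toQuotient φ) (s := (B : Set A)) (t := S) (fun s hs => hS.prop.1 hs)
  exact ⟨T, hTB, hT.injOn, hT.image_eq.symm ▸ hS⟩

lemma bddAbove_defect (x : A) (B : Submodule ℂ A) (φ : A →ₚ[ℂ] ℂ) :
    BddAbove {r | ∃ T : Set A, RepresentsBasis φ B T ∧ r = defect φ x T} := by
  refine ⟨(φ (star x * x)).re, ?_⟩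
  rintro r ⟨T, -, rfl⟩
  exact sub_le_self _ (tsum_nonneg fun b => by positivity)

end CStarDist

end

/-! For every state `φ`, `M(φ) ≤ φ ((a - b₀)* (a - b₀)) ≤ ‖a - b₀‖²`, so the point is to find a
state for which both are equalities. Put `x = a - b₀` and `P = ‖x‖² - x* x ≥ 0`. It suffices that a
state vanishes on the subspace `W = ℂ P + x* B`: it then has `φ (x* x) = ‖x‖²`, and all the sums in
`M(φ)` are zero.

By Riesz extension, with `1` as order unit, such a state exists unless `r ≤ ℜ w` for some `w ∈ W`
and some `r > 0`, say `r ≤ s P + ℜ (x* b)`. In that case, for small `t > 0`, the expansion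
`(x - t b)* (x - t b) = ‖x‖² - 2t (s P + ℜ (x* b)) - (1 - 2ts) P + t² b* b` gives
`‖x - t b‖² ≤ ‖x‖² - 2tr + t² ‖b‖² < ‖x‖²`, and `b₀ + t b` is a better approximation than `b₀`. -/

noncomputable section

open ComplexStarModule Filter Topology

namespace CStarDist

theorem exists_positiveLinearMap_eq_one_eq_zero_on {E : Type*} [AddCommGroup E] [PartialOrder E]
    [IsOrderedAddMonoid E] [Module ℝ E] [PosSMulMono ℝ E] {e : E}
    (he : ∀ y, ∃ t : ℝ, y ≤ t • e) {W : Submodule ℝ E}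
    (hW : ∀ w ∈ W, ∀ t : ℝ, t • e ≤ w → t ≤ 0) :
    ∃ g : E →ₚ[ℝ] ℝ, g e = 1 ∧ ∀ w ∈ W, g w = 0 := by
  have he_notMem : e ∉ W := fun h => one_pos.not_ge (hW e h 1 (one_smul ℝ e).le)
  let f : E →ₗ.[ℝ] ℝ := (⟨W, 0⟩ : E →ₗ.[ℝ] ℝ).supSpanSingleton e 1 he_notMem
  have hf_nonneg (x : f.domain) (hx : (x : E) ∈ PointedCone.positive ℝ E) : 0 ≤ f x := by
    obtain ⟨_, hmem⟩ := x
    obtain ⟨w, hw, _, hte, rfl⟩ := Submodule.mem_sup.1 hmem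
    obtain ⟨t, rfl⟩ := Submodule.mem_span_singleton.1 hte
    rw [PointedCone.mem_positive, ← neg_le_iff_add_nonneg, ← neg_smul] at hx
    have hf_apply : f ⟨w + t • e, hmem⟩ = t := by
      simpa [f] using LinearPMap.supSpanSingleton_apply_mk ⟨W, 0⟩ e (1 : ℝ) he_notMem w hw t
    rw [hf_apply, ← neg_nonpos]
    exact hW w hw (-t) hx
  obtain ⟨g, hgf, hg⟩ := riesz_extension (PointedCone.positive ℝ E) f hf_nonneg fun y => by
    obtain ⟨t, ht⟩ := he (-y)
    exact ⟨⟨t • e, Submodule.mem_sup_right (Submodule.mem_span_singleton.2 ⟨t, rfl⟩)⟩,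
      neg_le_iff_add_nonneg.1 ht⟩
  refine ⟨.mk₀ g hg, ?_, fun w hw => ?_⟩
  · exact (hgf ⟨e, _⟩).trans (LinearPMap.supSpanSingleton_apply_self _ _ he_notMem)
  · exact (hgf ⟨w, _⟩).trans (LinearPMap.supSpanSingleton_apply_mk_of_mem _ _ he_notMem hw)

section ComplexExtension

variable {A : Type*} [NonUnitalRing A] [StarRing A] [PartialOrder A] [StarOrderedRing A]
  [Module ℂ A] [StarModule ℂ A]

/-- The positive `ℂ`-linear functional `c ↦ g (ℜ c) + i g (ℑ c)` on `A` that extends a positive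
functional `g` on the self-adjoint part, so that states can be constructed by real Riesz extension.
It is built from its real part `c ↦ g (ℜ c)`. -/
def complexExtension (g : selfAdjoint A →ₚ[ℝ] ℝ) : A →ₚ[ℂ] ℂ :=
  .mk₀ (Module.Dual.extendRCLike (𝕜 := ℂ) (g.toLinearMap ∘ₗ realPart)) fun c hc => by
    have him : ℑ c = 0 := (nonneg_iff_realPart_imaginaryPart.1 hc).2
    have hre : 0 ≤ g (ℜ c) := g.map_nonneg (realPart_nonneg_of_nonneg hc)
    simpa [Module.Dual.extendRCLike_apply, realPart_I_smul, him] using hre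

lemma complexExtension_apply (g : selfAdjoint A →ₚ[ℝ] ℝ) (c : A) :
    complexExtension g c = g (ℜ c) + Complex.I * g (ℑ c) := by
  refine (Module.Dual.extendRCLike_apply _ c).trans ?_
  simp [realPart_I_smul]

end ComplexExtension

section States

variable {A : Type*} [CStarAlgebra A] [PartialOrder A] [StarOrderedRing A]

theorem exists_state_eq_zero_on {W : Submodule ℂ A}
    (hW : ∀ w ∈ W, ∀ r : ℝ, algebraMap ℝ A r ≤ ℜ w → r ≤ 0) :
    ∃ φ ∈ states A, ∀ w ∈ W, φ w = 0 := by
  have : PosSMulMono ℝ (selfAdjoint A) :=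
    ⟨fun _ hr _ _ hcd => smul_le_smul_of_nonneg_left (β := A) hcd hr⟩
  have hunit (c : selfAdjoint A) : ∃ t : ℝ, c ≤ t • 1 := by
    refine ⟨‖(c : A)‖, ?_⟩
    simpa [← Subtype.coe_le_coe, Algebra.algebraMap_eq_smul_one] using
      c.2.le_algebraMap_norm_self
  obtain ⟨g, hg_one, hgW⟩ := exists_positiveLinearMap_eq_one_eq_zero_on hunit
    (W := (W.restrictScalars ℝ).map realPart) (by
      rintro _ ⟨w, hw, rfl⟩ r hr
      refine hW w hw r ?_
      simpa [← Subtype.coe_le_coe, Algebra.algebraMap_eq_smul_one] using hr)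
  have hg_realPart (w : A) (hw : w ∈ W) : g (ℜ w) = 0 := hgW _ (Submodule.mem_map_of_mem hw)
  refine ⟨complexExtension g, ?_, fun w hw => ?_⟩
  · simp [states, complexExtension_apply, hg_one, (IsSelfAdjoint.one A).imaginaryPart]
  · have hg_imaginaryPart : g (ℑ w) = 0 := by
      simpa [realPart_I_smul] using hg_realPart _ (W.smul_mem Complex.I hw)
    simp [complexExtension_apply, hg_realPart w hw, hg_imaginaryPart]

lemma map_algebraMap_of_mem_states {φ : A →ₚ[ℂ] ℂ} (hφ : φ ∈ states A) (r : ℝ) :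
    φ (algebraMap ℝ A r) = r := by
  have hone : φ 1 = 1 := hφ
  rw [IsScalarTower.algebraMap_apply ℝ ℂ A, Algebra.algebraMap_eq_smul_one, map_smul, hone]
  simp

lemma re_map_star_mul_self_le {φ : A →ₚ[ℂ] ℂ} (hφ : φ ∈ states A) (x : A) :
    (φ (star x * x)).re ≤ ‖x‖ ^ 2 := by
  have h : φ (star x * x) ≤ φ (algebraMap ℝ A (‖x‖ ^ 2)) :=
    OrderHomClass.mono φ CStarAlgebra.star_mul_le_algebraMap_norm_sq
  rw [map_algebraMap_of_mem_states hφ] at h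
  exact (Complex.le_def.1 h).1

end States

section Orthogonality

lemma star_sub_smul_mul_self {A : Type*} [NonUnitalRing A] [StarRing A] [Module ℂ A]
    [IsScalarTower ℂ A A] [SMulCommClass ℂ A A] [StarModule ℂ A] (x b : A) (t : ℝ) :
    star (x - t • b) * (x - t • b) =
      star x * x - (2 * t) • (ℜ (star x * b) : A) + t ^ 2 • (star b * b) := by
  simp only [realPart_apply_coe, star_sub, star_smul, star_trivial, star_mul, star_star, sub_mul,
    mul_sub, smul_mul_assoc, mul_smul_comm]
  module

variable {A : Type*} [CStarAlgebra A] [PartialOrder A] [StarOrderedRing A]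

lemma norm_sq_le_of_star_mul_self_le [Nontrivial A] {y : A} {r : ℝ}
    (h : star y * y ≤ algebraMap ℝ A r) : ‖y‖ ^ 2 ≤ r := by
  have hy : 0 ≤ star y * y := star_mul_self_nonneg y
  have hr : 0 ≤ r := by
    rw [← algebraMap_le_algebraMap (β := A), map_zero]
    exact hy.trans h
  rw [sq, ← CStarRing.norm_star_mul_self]
  exact (CStarAlgebra.norm_le_iff_le_algebraMap _ hr).2 h

lemma norm_sub_smul_sq_le [Nontrivial A] {x b : A} {r s t : ℝ}
    (h : algebraMap ℝ A r ≤
      s • (algebraMap ℝ A (‖x‖ ^ 2) - star x * x) + (ℜ (star x * b) : A))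
    (ht : 0 ≤ t) (hts : 2 * t * s ≤ 1) :
    ‖x - t • b‖ ^ 2 ≤ ‖x‖ ^ 2 - 2 * t * r + t ^ 2 * ‖b‖ ^ 2 := by
  apply norm_sq_le_of_star_mul_self_le
  set P : A := algebraMap ℝ A (‖x‖ ^ 2) - star x * x with hP
  have hP_nonneg : 0 ≤ P := sub_nonneg.2 CStarAlgebra.star_mul_le_algebraMap_norm_sq
  have hb : star b * b ≤ algebraMap ℝ A (‖b‖ ^ 2) := CStarAlgebra.star_mul_le_algebraMap_norm_sq
  calc star (x - t • b) * (x - t • b)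
      = algebraMap ℝ A (‖x‖ ^ 2) - (2 * t) • (s • P + (ℜ (star x * b) : A))
          - (1 - 2 * t * s) • P + t ^ 2 • (star b * b) := by
        rw [star_sub_smul_mul_self, hP]
        module
    _ ≤ algebraMap ℝ A (‖x‖ ^ 2) - (2 * t) • algebraMap ℝ A r
          - (1 - 2 * t * s) • (0 : A) + t ^ 2 • algebraMap ℝ A (‖b‖ ^ 2) := by
        have : 0 ≤ 1 - 2 * t * s := sub_nonneg.2 hts
        gcongr
    _ = algebraMap ℝ A (‖x‖ ^ 2 - 2 * t * r + t ^ 2 * ‖b‖ ^ 2) := by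
        simp only [Algebra.algebraMap_eq_smul_one]
        module

lemma nonpos_of_algebraMap_le_realPart [Nontrivial A] {x b : A} {r s : ℝ}
    (hx : ∀ t : ℝ, ‖x‖ ≤ ‖x - t • b‖)
    (h : algebraMap ℝ A r ≤
      s • (algebraMap ℝ A (‖x‖ ^ 2) - star x * x) + (ℜ (star x * b) : A)) :
    r ≤ 0 := by
  have hlim : Tendsto (fun t : ℝ => t * ‖b‖ ^ 2) (𝓝[>] 0) (𝓝 0) := by
    have : Continuous fun t : ℝ => t * ‖b‖ ^ 2 := by fun_prop
    simpa using (this.tendsto 0).mono_left nhdsWithin_le_nhds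
  have hsmall : ∀ᶠ t : ℝ in 𝓝[>] 0, 2 * t * s < 1 := by
    have : Continuous fun t : ℝ => 2 * t * s := by fun_prop
    exact nhdsWithin_le_nhds (this.tendsto 0 |>.eventually_lt_const (by simp))
  have hbound : ∀ᶠ t : ℝ in 𝓝[>] 0, 2 * r ≤ t * ‖b‖ ^ 2 := by
    filter_upwards [hsmall, self_mem_nhdsWithin] with t hts (ht : 0 < t)
    have hle : ‖x‖ ^ 2 ≤ ‖x‖ ^ 2 - 2 * t * r + t ^ 2 * ‖b‖ ^ 2 :=
      (pow_le_pow_left₀ (norm_nonneg x) (hx t) 2).trans (norm_sub_smul_sq_le h ht.le hts.le)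
    refine le_of_mul_le_mul_left ?_ ht
    linarith
  linarith [ge_of_tendsto hlim hbound]

theorem exists_state_norm_sq_eq_orthogonal [Nontrivial A] {x : A} {B : Submodule ℂ A}
    (hx : ∀ b ∈ B, ‖x‖ ≤ ‖x - b‖) :
    ∃ φ ∈ states A, φ (star x * x) = (‖x‖ ^ 2 : ℝ) ∧ ∀ b ∈ B, φ (star x * b) = 0 := by
  set P : A := algebraMap ℝ A (‖x‖ ^ 2) - star x * x with hP
  have hP_sa : IsSelfAdjoint P := (IsSelfAdjoint.algebraMap A (.all _)).sub (.star_mul_self x)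
  obtain ⟨φ, hφ, hφ_zero⟩ := exists_state_eq_zero_on
    (W := Submodule.span ℂ {P} ⊔ B.map (LinearMap.mulLeft ℂ (star x))) (by
      intro w hw r hr
      obtain ⟨_, hzP, _, ⟨b, hb, rfl⟩, rfl⟩ := Submodule.mem_sup.1 hw
      obtain ⟨z, rfl⟩ := Submodule.mem_span_singleton.1 hzP
      refine nonpos_of_algebraMap_le_realPart (x := x) (b := b) (s := z.re)
        (fun t => hx _ ((B.restrictScalars ℝ).smul_mem t hb)) ?_
      rw [← hP]
      simpa [realPart_smul, hP_sa.imaginaryPart, hP_sa.coe_realPart] using hr)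
  refine ⟨φ, hφ, ?_, fun b hb => hφ_zero _ (Submodule.mem_sup_right (Submodule.mem_map_of_mem hb))⟩
  have hφP : φ P = 0 :=
    hφ_zero P (Submodule.mem_sup_left (Submodule.mem_span_singleton_self P))
  rw [hP, map_sub, map_algebraMap_of_mem_states hφ, sub_eq_zero] at hφP
  exact hφP.symm

end Orthogonality

section BestApproximation

variable {A : Type*} [CStarAlgebra A] {a b₀ : A} {B : Submodule ℂ A}

lemma IsBestApprox.infDist_eq (h : IsBestApprox a B b₀) :
    Metric.infDist a (B : Set A) = ‖a - b₀‖ := by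
  refine le_antisymm ?_ ((Metric.le_infDist ⟨b₀, h.1⟩).2 fun b hb => ?_)
  · exact (Metric.infDist_le_dist_of_mem h.1).trans_eq (dist_eq_norm _ _)
  · exact (h.2 b hb).trans_eq (dist_eq_norm _ _).symm

lemma IsBestApprox.norm_sub_le_norm_sub_sub (h : IsBestApprox a B b₀) {b : A} (hb : b ∈ B) :
    ‖a - b₀‖ ≤ ‖a - b₀ - b‖ := by
  rw [sub_sub]
  exact h.2 _ (B.add_mem h.1 hb)

variable [PartialOrder A] {φ : A →ₚ[ℂ] ℂ}

lemma defect_le (φ : A →ₚ[ℂ] ℂ) (x : A) (T : Set A) :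
    defect φ x T ≤ (φ (star x * x)).re :=
  sub_le_self _ (tsum_nonneg fun _ => by positivity)

lemma defect_eq_of_orthogonal {x : A} {T : Set A} (h : ∀ b ∈ T, φ (star x * b) = 0) :
    defect φ x T = (φ (star x * x)).re := by
  have hterm (b : T) : ‖φ (star x * (b : A))‖ ^ 2 = 0 := by simp [h b b.2]
  rw [defect, tsum_congr hterm, tsum_zero, sub_zero]

variable [StarOrderedRing A]

lemma M_le (a : A) (B : Submodule ℂ A) (b₀ : A) (φ : A →ₚ[ℂ] ℂ) :
    M a B b₀ φ ≤ (φ (star (a - b₀) * (a - b₀))).re := by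
  obtain ⟨T, hT⟩ := exists_representsBasis φ B
  refine csSup_le ⟨_, T, hT, rfl⟩ ?_
  rintro _ ⟨T, -, rfl⟩
  exact defect_le φ _ T

lemma M_eq_of_orthogonal (h : ∀ b ∈ B, φ (star (a - b₀) * b) = 0) :
    M a B b₀ φ = (φ (star (a - b₀) * (a - b₀))).re := by
  obtain ⟨T, hT⟩ := exists_representsBasis φ B
  exact (M_le a B b₀ φ).antisymm (le_csSup (bddAbove_defect _ B φ)
    ⟨T, hT, (defect_eq_of_orthogonal fun b hb => h b (hT.1 hb)).symm⟩)

end BestApproximation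

end CStarDist

end

theorem mainTheorem2 {A : Type*} [CStarAlgebra A] [Nontrivial A] [PartialOrder A]
    [StarOrderedRing A] (a : A) (B : Submodule ℂ A) (b₀ : A)
    (hb₀ : CStarDist.IsBestApprox a B b₀) :
    IsGreatest (CStarDist.M a B b₀ '' CStarDist.states A)
      (Metric.infDist a (B : Set A) ^ 2) := by
  rw [hb₀.infDist_eq]
  constructor
  · obtain ⟨φ, hφ, hnorm, horth⟩ := CStarDist.exists_state_norm_sq_eq_orthogonal
      fun _ hb => hb₀.norm_sub_le_norm_sub_sub hb
    exact ⟨φ, hφ, by rw [CStarDist.M_eq_of_orthogonal horth, hnorm, Complex.ofReal_re]⟩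
  · rintro _ ⟨φ, hφ, rfl⟩
    exact (CStarDist.M_le a B b₀ φ).trans (CStarDist.re_map_star_mul_self_le hφ _)
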